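/- There is an absolute constant $c>0$, and for every real $\varepsilon>0$ there are constants $C_1,C_2>0$ depending only on $\varepsilon$, such that for all integers $B\ge 1$ and $n\ge 2$ there is a (non-interactive) $\varepsilon$-differentially private protocol in the shuffled model for $n$ users that computes histograms over a domain of size $B$ with expected $\ell_\infty$ error at most $C_1\log B\log n$, in which each user sends at most $C_2\,B\log n$ messages, each consisting of $\ell$ bits for some integer $\ell\le c\log B$ (depending only on the protocol). Here a shuffled-model protocol consists of a local randomizer $R$, which maps one user's input $x_i\in\{1,\dots,B\}$ to a random finite sequence of messages, using independent private randomness for each user; a shuffler $S$, which outputs a uniformly random permutation of the concatenation of $R(x_1),\dots,R(x_n)$; and an analyzer $A$, which maps the output of the shuffler to an estimate $y\in\mathbb R^B$. The protocol is $\varepsilon$-differentially private in the shuffled model if, for all datasets $X,X'\in\{1,\dots,B\}^n$ differing on a single user's data and every set $\mathcal S$ of shuffler outputs, $$\Pr[S(R(x_1),\dots,R(x_n))\in\mathcal S]\le e^{\varepsilon}\Pr[S(R(x_1'),\dots,R(x_n'))\in\mathcal S].$$ The expected $\ell_\infty$ error bound means that for every dataset $X\in\{1,\dots,B\}^n$,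 $\mathbb E\big[\max_{1\le j\le B}|y_j-|\{i: x_i=j\}||\big]\le C_1\log B\log n$. The bounds on the number and the length of messages hold for every input and every outcome of the randomness. -/

import Mathlib

noncomputable section

namespace ShuffledDP

/-- The mechanism `mech`, which maps a dataset of `n` users to the law of its transcript, is
`(ε, δ)`-differentially private: for datasets that differ on the data of a single user `i`, and
for every set `S` of transcripts, `Pr[mech x ∈ S] ≤ e ^ ε * Pr[mech x' ∈ S] + δ`. -/
def IsDP {X T : Type} {n : ℕ} (mech : (Fin n → X) → PMF T) (ε δ : ℝ) : Prop :=
  ∀ (x x' : Fin n → X) (i : Fin n), (∀ j, j ≠ i → x j = x' j) → ∀ S : Set T,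
    (mech x).toOuterMeasure S
      ≤ ENNReal.ofReal (Real.exp ε) * (mech x').toOuterMeasure S + ENNReal.ofReal δ

/-- The shuffler: a uniformly random permutation of the list of messages that it receives. -/
def shuffle {M : Type} (l : List M) : PMF (List M) :=
  (PMF.uniformOfFintype (Equiv.Perm (Fin l.length))).map
    fun σ => List.ofFn fun i => l.get (σ i)

/-- The concatenation of independent outputs of the randomizer `R` on the entries of a list. -/
def concatOutputs {X M : Type} (R : X → PMF (List M)) : List X → PMF (List M)
  | [] => PMF.pure []
  | x :: xs => (R x).bind fun u => (concatOutputs R xs).map fun v => u ++ v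

/-- A non-interactive protocol in the shuffled model, with user inputs in `X`, messages in `M` and
outputs in `Y`: a local randomizer, which maps the input of one user to a random sequence of
messages, and a (possibly randomized) analyzer, which maps the output of the shuffler to the output
of the protocol. The shuffler is always `shuffle`. -/
structure Protocol (X M Y : Type) where
  randomizer : X → PMF (List M)
  analyzer : List M → PMF Y

namespace Protocol

variable {X M Y : Type}

/-- The law of the output of the shuffler `S(R(x₁), …, R(xₙ))`, which is what the analyzer sees. -/
def transcript (P : Protocol X M Y) {n : ℕ} (x : Fin n → X) : PMF (List M) :=
  (concatOutputs P.randomizer (List.ofFn x)).bind shuffle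

/-- The law of the output of the protocol. -/
def output (P : Protocol X M Y) {n : ℕ} (x : Fin n → X) : PMF Y :=
  (P.transcript x).bind P.analyzer

/-- For `n` users, the protocol is `(ε, δ)`-DP in the shuffled model. -/
def IsShuffledDP (P : Protocol X M Y) (n : ℕ) (ε δ : ℝ) : Prop :=
  IsDP (fun x : Fin n → X => P.transcript x) ε δ

/-- For `n` users, the protocol is (purely) `ε`-DP in the shuffled model. -/
def IsPureShuffledDP (P : Protocol X M Y) (n : ℕ) (ε : ℝ) : Prop :=
  P.IsShuffledDP n ε 0

/-- Each user always sends at most `m` messages. -/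
def SendsAtMost (P : Protocol X M Y) (m : ℝ) : Prop :=
  ∀ x : X, ∀ u ∈ (P.randomizer x).support, (u.length : ℝ) ≤ m

end Protocol

/-- The histogram of a dataset over a domain of size `B`: entry `j` is the number of users that
hold the element `j`. -/
def histogram {B n : ℕ} (x : Fin n → Fin B) (j : Fin B) : ℝ :=
  ((Finset.univ.filter fun i => x i = j).card : ℝ)

/-- The expected `ℓ∞` error, as an extended nonnegative real, of a protocol for histograms on the
dataset `x`. The norm on `Fin B → ℝ` is the maximum norm. -/
def expectedError {B n : ℕ} {M : Type} (P : Protocol (Fin B) M (Fin B → ℝ)) (x : Fin n → Fin B) :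
    ENNReal :=
  ∑' y : Fin B → ℝ, P.output x y * ENNReal.ofReal ‖y - histogram x‖

end ShuffledDP

end

open scoped ENNReal

/-! For every coordinate `j` of the one-hot encoding, a user sends copies of message `j`: usually
`center` plus the bit, but with probability O(1/n) a number drawn from a two-sided exponentially
decaying law on {0, …, 2 * center}, where `center` is of order log n. On average O(1) users per
coordinate are noisy, each moving a count by O(log n). Exponential moments and a soft maximum over
the B coordinates give the error bound.

Privacy: the shuffler reveals only the message counts, whose generating function is a product over
coordinates and users of factors `α * X ^ (center + c) + β * g(X)`. The coefficientwise order on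
series over `ℝ≥0∞` respects products, so it suffices to compare two products that differ in one bit
(`noise_swap_le`). If another user is noisy, its noise is shifted by one to hide the change. This
costs a constant factor, except at an end of the noise range. The end term is absorbed by the event
that the changed user is noisy as well, which is about n times rarer, so the end weight must be
about 1/n times a product of two other weights; a convex exponent achieves this. If no other user is
noisy, the term is compared with those in which exactly one is: there are n - 1 of them, each of
relative weight about l/n, so a large constant l suffices. -/

namespace ShuffledDP

/-! ### An ordered semiring argument for noisy sums -/

section Semiring

variable {R : Type*} [CommSemiring R] [PartialOrder R] [IsOrderedRing R] [CanonicallyOrderedAdd R]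

/-- If multiplication of the noise `g` by `s` rather than by `t` costs a factor `e` up to a multiple
of `g ^ 2`, then the same is true for a product of factors `α * c + β * g`, up to the term in which
no factor contributes noise. -/
theorem mul_prod_noise_le {α β g s t e b : R} (hg : s * g ≤ e * (t * g) + b * (g * g))
    (cs : List R) :
    s * (cs.map fun c => α * c + β * g).prod
      ≤ e * (t * (cs.map fun c => α * c + β * g).prod)
        + b * (g * (cs.map fun c => α * c + β * g).prod) + s * (cs.map fun c => α * c).prod := by
  induction cs with
  | nil => simp
  | cons c cs ih =>
    simp only [List.map_cons, List.prod_cons]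
    generalize (cs.map fun c => α * c + β * g).prod = F at *
    generalize (cs.map fun c => α * c).prod = U at *
    -- The new factor either keeps its signal, and induction applies to the rest, or is noise, and
    -- `hg` applies to it.
    calc s * ((α * c + β * g) * F) = α * c * (s * F) + β * (s * g) * F := by ring
      _ ≤ α * c * (e * (t * F) + b * (g * F) + s * U)
          + β * (e * (t * g) + b * (g * g)) * F := by gcongr
      _ = _ := by ring

omit [IsOrderedRing R] in
theorem prod_signal_le_prod_noise {α β g : R} (cs : List R) :
    (cs.map fun c => α * c).prod ≤ (cs.map fun c => α * c + β * g).prod := by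
  induction cs with
  | nil => simp
  | cons c cs ih =>
    simp only [List.map_cons, List.prod_cons]
    gcongr
    exact le_self_add

/-- The term in which no factor contributes noise is dominated by the terms in which exactly one
factor does. -/
theorem length_mul_prod_signal_le {α β g s t κ : R} (cs : List R)
    (hc : ∀ c ∈ cs, α * (s * c) ≤ κ * (β * (t * g))) :
    cs.length * (s * (cs.map fun c => α * c).prod)
      ≤ κ * (t * (cs.map fun c => α * c + β * g).prod) := by
  induction cs with
  | nil => simp
  | cons c cs ih =>
    have ih := ih fun c hc' => hc c (List.mem_cons_of_mem _ hc')
    have hc := hc c List.mem_cons_self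
    have hU := prod_signal_le_prod_noise (α := α) (β := β) (g := g) cs
    simp only [List.map_cons, List.prod_cons, List.length_cons, Nat.cast_add, Nat.cast_one]
    generalize (cs.map fun c => α * c + β * g).prod = F at *
    generalize (cs.map fun c => α * c).prod = U at *
    calc ((cs.length : R) + 1) * (s * (α * c * U))
        = α * c * (cs.length * (s * U)) + α * (s * c) * U := by ring
      _ ≤ α * c * (κ * (t * F)) + κ * (β * (t * g)) * F := by gcongr
      _ = _ := by ring

/-- Replacing one factor `α * s + β * g` by `α * t + β * g` in a product of such factors costs a
constant factor `E`. -/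
theorem noise_swap_le {α β g s t e b κ κ' w E : R} (cs : List R)
    (hg : s * g ≤ e * (t * g) + b * (g * g))
    (hc : ∀ c ∈ cs, α * (s * c) ≤ κ * (β * (t * g)))
    (hw : w * cs.length = 1) (hκ : w * κ ≤ κ') (hE : e + κ' ≤ E) (hb : α * b + β ≤ E * β) :
    (α * s + β * g) * (cs.map fun c => α * c + β * g).prod
      ≤ E * ((α * t + β * g) * (cs.map fun c => α * c + β * g).prod) := by
  have h1 := mul_prod_noise_le (α := α) (β := β) hg cs
  have h2 := length_mul_prod_signal_le cs hc
  generalize (cs.map fun c => α * c + β * g).prod = F at *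
  generalize (cs.map fun c => α * c).prod = U at *
  -- `w` is the inverse of the number of factors, so this averages over the factor that turns noisy.
  have h3 : s * U ≤ κ' * (t * F) :=
    calc s * U = w * (cs.length * (s * U)) := by rw [← mul_assoc, hw, one_mul]
      _ ≤ w * (κ * (t * F)) := by gcongr
      _ = w * κ * (t * F) := by ring
      _ ≤ _ := by gcongr
  calc (α * s + β * g) * F = α * (s * F) + β * (g * F) := by ring
    _ ≤ α * (e * (t * F) + b * (g * F) + κ' * (t * F)) + β * (g * F) := by
      gcongr
      exact h1.trans (by gcongr)
    _ = (e + κ') * (α * (t * F)) + (α * b + β) * (g * F) := by ring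
    _ ≤ E * (α * (t * F)) + E * β * (g * F) := by gcongr
    _ = _ := by ring

/-- The noise polynomial with weights `a 0, …, a N`. -/
def noisePoly (a : ℕ → R) (N : ℕ) (X : R) : R := ∑ k ∈ Finset.range (N + 1), a k * X ^ k

omit [IsOrderedRing R] in
theorem term_le_noisePoly (a : ℕ → R) {N k : ℕ} (hk : k ≤ N) (X : R) :
    a k * X ^ k ≤ noisePoly a N X :=
  Finset.single_le_sum_of_canonicallyOrdered (f := fun k => a k * X ^ k)
    (Finset.mem_range.2 (by omega))

/-- Neighbouring weights are comparable, so a shift by one costs `e`; only the top monomial is left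
over. Its degree is `i + j`, so it also occurs in the square of the noise. -/
theorem pow_succ_mul_noisePoly_le {a : ℕ → R} {N m i j : ℕ} {e b : R} (X : R)
    (ha : ∀ k < N, a k ≤ e * a (k + 1)) (hi : i ≤ N) (hj : j ≤ N) (hij : i + j = m + 1 + N)
    (hb : a N ≤ b * (a i * a j)) :
    X ^ (m + 1) * noisePoly a N X
      ≤ e * (X ^ m * noisePoly a N X) + b * (noisePoly a N X * noisePoly a N X) := by
  have hlast : X ^ (m + 1) * (a N * X ^ N) ≤ b * (noisePoly a N X * noisePoly a N X) :=
    calc X ^ (m + 1) * (a N * X ^ N) ≤ X ^ (m + 1) * (b * (a i * a j) * X ^ N) := by gcongr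
      _ = b * (a i * a j * X ^ (m + 1 + N)) := by ring
      _ = b * ((a i * X ^ i) * (a j * X ^ j)) := by rw [← hij]; ring
      _ ≤ _ := by gcongr <;> exact term_le_noisePoly a ‹_› X
  have hinit : X ^ (m + 1) * ∑ k ∈ Finset.range N, a k * X ^ k
      ≤ e * (X ^ m * noisePoly a N X) :=
    calc X ^ (m + 1) * ∑ k ∈ Finset.range N, a k * X ^ k
        = ∑ k ∈ Finset.range N, X ^ m * (a k * X ^ (k + 1)) := by
          rw [Finset.mul_sum]; exact Finset.sum_congr rfl fun k _ => by ring
      _ ≤ ∑ k ∈ Finset.range N, X ^ m * (e * a (k + 1) * X ^ (k + 1)) := by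
          gcongr with k hk
          exact ha k (Finset.mem_range.1 hk)
      _ = e * (X ^ m * ∑ k ∈ Finset.range N, a (k + 1) * X ^ (k + 1)) := by
          simp only [Finset.mul_sum]; exact Finset.sum_congr rfl fun k _ => by ring
      _ ≤ _ := by
          rw [noisePoly, Finset.sum_range_succ']
          gcongr
          exact le_self_add
  conv_lhs => rw [noisePoly, Finset.sum_range_succ, mul_add]
  exact add_le_add hinit hlast

/-- The mirror image: in a downward shift the lowest monomial is left over. -/
theorem pow_mul_noisePoly_le {a : ℕ → R} {N m i j : ℕ} {e b : R} (X : R)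
    (ha : ∀ k < N, a (k + 1) ≤ e * a k) (hi : i ≤ N) (hj : j ≤ N) (hij : i + j = m)
    (hb : a 0 ≤ b * (a i * a j)) :
    X ^ m * noisePoly a N X
      ≤ e * (X ^ (m + 1) * noisePoly a N X) + b * (noisePoly a N X * noisePoly a N X) := by
  have hlast : X ^ m * (a 0 * X ^ 0) ≤ b * (noisePoly a N X * noisePoly a N X) :=
    calc X ^ m * (a 0 * X ^ 0) ≤ X ^ m * (b * (a i * a j) * X ^ 0) := by gcongr
      _ = b * ((a i * X ^ i) * (a j * X ^ j)) := by rw [← hij]; ring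
      _ ≤ _ := by gcongr <;> exact term_le_noisePoly a ‹_› X
  have hinit : X ^ m * ∑ k ∈ Finset.range N, a (k + 1) * X ^ (k + 1)
      ≤ e * (X ^ (m + 1) * noisePoly a N X) :=
    calc X ^ m * ∑ k ∈ Finset.range N, a (k + 1) * X ^ (k + 1)
        ≤ X ^ m * ∑ k ∈ Finset.range N, e * a k * X ^ (k + 1) := by
          gcongr with k hk
          exact ha k (Finset.mem_range.1 hk)
      _ = e * (X ^ (m + 1) * ∑ k ∈ Finset.range N, a k * X ^ k) := by
          simp only [Finset.mul_sum]; exact Finset.sum_congr rfl fun k _ => by ring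
      _ ≤ _ := by
          rw [noisePoly, Finset.sum_range_succ]
          gcongr
          exact le_self_add
  conv_lhs => rw [noisePoly, Finset.sum_range_succ', mul_add]
  exact add_le_add hinit hlast

end Semiring

/-! ### The coefficientwise order on power series -/

section Series

variable {σ : Type*}

instance : PartialOrder (MvPowerSeries σ ℝ≥0∞) :=
  inferInstanceAs (PartialOrder ((σ →₀ ℕ) → ℝ≥0∞))

theorem series_le_iff {p q : MvPowerSeries σ ℝ≥0∞} :
    p ≤ q ↔ ∀ d, MvPowerSeries.coeff d p ≤ MvPowerSeries.coeff d q := Iff.rfl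

theorem series_mul_le_mul {p q r : MvPowerSeries σ ℝ≥0∞} (h : p ≤ q) : r * p ≤ r * q := by
  classical
  intro d
  change MvPowerSeries.coeff d (r * p) ≤ MvPowerSeries.coeff d (r * q)
  rw [MvPowerSeries.coeff_mul, MvPowerSeries.coeff_mul]
  exact Finset.sum_le_sum fun x _ => mul_le_mul_right (h x.2) _

instance : IsOrderedRing (MvPowerSeries σ ℝ≥0∞) where
  add_le_add_left _ _ h r := fun d => add_le_add_left (h d) (r d)
  zero_le_one := fun _ => zero_le
  mul_le_mul_of_nonneg_left _ _ _ _ h := series_mul_le_mul h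
  mul_le_mul_of_nonneg_right r _ _ _ h := by
    simpa only [mul_comm _ r] using series_mul_le_mul (r := r) h

instance : CanonicallyOrderedAdd (MvPowerSeries σ ℝ≥0∞) where
  exists_add_of_le {p q} h := ⟨fun d => q d - p d, funext fun d => (add_tsub_cancel_of_le (h d)).symm⟩
  le_add_self _ _ := fun _ => le_add_self
  le_self_add _ _ := fun _ => le_self_add

theorem C_le_C {a b : ℝ≥0∞} (h : a ≤ b) :
    (MvPowerSeries.C a : MvPowerSeries σ ℝ≥0∞) ≤ MvPowerSeries.C b := by
  classical
  rw [series_le_iff]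
  intro d
  rw [MvPowerSeries.coeff_C, MvPowerSeries.coeff_C]
  split_ifs
  exacts [h, le_rfl]

end Series

/-! ### The shuffler as a post-processing of the multiset of messages -/

/-- A bijection of positions that matches equal entries transports the uniform law on permutations
to the uniform law. -/
theorem shuffle_eq_of_perm {M : Type} {l l' : List M} (h : l.Perm l') : shuffle l = shuffle l' := by
  classical
  have hl : l.length = l'.length := h.length_eq
  have hbij : Function.Bijective h.idxBij :=
    Function.bijective_iff_has_inverse.2
      ⟨h.symm.idxBij, h.symm.idxBij_leftInverse_idxBij_symm, h.idxBij_leftInverse_idxBij_symm⟩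
  let τ : Fin l.length ≃ Fin l'.length := Equiv.ofBijective h.idxBij hbij
  have hτ : ∀ i, l'.get (τ i) = l.get i := fun i => h.getElem_idxBij_eq_getElem i
  let Φ : Equiv.Perm (Fin l.length) ≃ Equiv.Perm (Fin l'.length) :=
    (finCongr hl).equivCongr τ
  have hΦ : (PMF.uniformOfFintype (Equiv.Perm (Fin l.length))).map Φ
      = PMF.uniformOfFintype (Equiv.Perm (Fin l'.length)) := by
    ext σ
    rw [PMF.map_apply, tsum_eq_single (Φ.symm σ)]
    · simp [hl]
    · intro ρ hρ
      rw [if_neg]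
      rintro rfl
      simp at hρ
  rw [shuffle, shuffle, ← hΦ, PMF.map_comp]
  congr 1
  funext σ
  have : ∀ i, l'.get (Φ σ i) = l.get (σ (Fin.cast hl.symm i)) := fun i => by
    simp only [Φ, Equiv.equivCongr_apply_apply, hτ]
    rfl
  simp only [Function.comp_apply, this]
  apply List.ext_getElem
  · simp [hl]
  · intro i h1 h2
    simp

/-! ### Generating functions of message counts and privacy -/

section Transcript

variable {M : Type} [DecidableEq M]

/-- The number of occurrences of each message in a list. -/
noncomputable def messageCounts (l : List M) : M →₀ ℕ := Multiset.toFinsupp (l : Multiset M)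

theorem messageCounts_append (u v : List M) :
    messageCounts (u ++ v) = messageCounts u + messageCounts v := by
  rw [messageCounts, ← Multiset.coe_add, map_add]; rfl

theorem messageCounts_replicate (k : ℕ) (s : M) :
    messageCounts (List.replicate k s) = Finsupp.single s k := by
  ext t
  simp [messageCounts, List.count_replicate, Finsupp.single_apply]

theorem shuffle_eq_shuffle_messageCounts (l : List M) :
    shuffle l = shuffle (Multiset.toFinsupp.symm (messageCounts l)).toList := by
  apply shuffle_eq_of_perm
  rw [← Multiset.coe_eq_coe, Multiset.coe_toList, messageCounts]
  simp

/-- The generating function of the message counts of a random list of messages. -/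
noncomputable def series (μ : PMF (List M)) : MvPowerSeries M ℝ≥0∞ := fun d => μ.map messageCounts d

theorem coeff_series (μ : PMF (List M)) (d : M →₀ ℕ) :
    MvPowerSeries.coeff d (series μ) = μ.map messageCounts d := rfl

theorem bind_map_add_apply (p q : PMF (M →₀ ℕ)) (d : M →₀ ℕ) :
    (p.bind fun a => q.map fun b => a + b) d = ∑ x ∈ Finset.HasAntidiagonal.antidiagonal d, p x.1 * q x.2 := by
  simp only [PMF.bind_apply, PMF.map_apply, ← ENNReal.tsum_mul_left]
  refine ENNReal.tsum_prod.symm.trans ?_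
  rw [tsum_eq_sum (s := Finset.HasAntidiagonal.antidiagonal d)]
  · refine Finset.sum_congr rfl fun x hx => ?_
    rw [if_pos (Finset.HasAntidiagonal.mem_antidiagonal.1 hx).symm]
  · intro x hx
    rw [if_neg fun h => hx (Finset.HasAntidiagonal.mem_antidiagonal.2 h.symm), mul_zero]

theorem series_bind_append (μ ν : PMF (List M)) :
    series (μ.bind fun u => ν.map fun v => u ++ v) = series μ * series ν := by
  ext d
  rw [MvPowerSeries.coeff_mul, coeff_series]
  simp only [coeff_series]
  rw [← bind_map_add_apply, PMF.map_bind, PMF.bind_map]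
  simp only [PMF.map_comp, Function.comp_def, messageCounts_append]

theorem series_concatOutputs {X : Type} (R : X → PMF (List M)) (xs : List X) :
    series (concatOutputs R xs) = (xs.map fun x => series (R x)).prod := by
  induction xs with
  | nil =>
    ext d
    rw [concatOutputs, coeff_series, PMF.pure_map, PMF.pure_apply]
    simp [MvPowerSeries.coeff_one, messageCounts]
  | cons x xs ih => rw [concatOutputs, series_bind_append, ih, List.map_cons, List.prod_cons]

/-- The shuffled list is a post-processing of the counts, so a coefficientwise bound passes to every
event. -/
theorem toOuterMeasure_bind_shuffle_le {μ ν : PMF (List M)} {E : ℝ≥0∞}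
    (h : series μ ≤ MvPowerSeries.C E * series ν) (S : Set (List M)) :
    (μ.bind shuffle).toOuterMeasure S ≤ E * (ν.bind shuffle).toOuterMeasure S := by
  have key : ∀ μ : PMF (List M), μ.bind shuffle = (μ.map messageCounts).bind
      fun d => shuffle (Multiset.toFinsupp.symm d).toList := fun μ => by
    rw [PMF.bind_map]
    congr 1
    funext l
    exact shuffle_eq_shuffle_messageCounts l
  rw [key μ, key ν, PMF.toOuterMeasure_bind_apply, PMF.toOuterMeasure_bind_apply,
    ← ENNReal.tsum_mul_left]
  refine ENNReal.tsum_le_tsum fun d => ?_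
  rw [← mul_assoc]
  gcongr
  have := series_le_iff.1 h d
  rwa [MvPowerSeries.coeff_C_mul] at this

/-- The randomizer that treats the coordinates of the one-hot encoding of its input
independently. -/
noncomputable def oneHotRandomizer {B : ℕ} (blk : Fin B → Bool → PMF (List M)) (y : Fin B) : PMF (List M) :=
  concatOutputs (fun j => blk j (decide (j = y))) (List.finRange B)

/-- Counts forget order, so the factors can be regrouped by coordinate. -/
theorem series_oneHot {B n : ℕ} (blk : Fin B → Bool → PMF (List M)) (x : Fin n → Fin B) :
    series (concatOutputs (oneHotRandomizer blk) (List.ofFn x))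
      = ∏ j, ∏ i, series (blk j (decide (j = x i))) := by
  rw [series_concatOutputs, List.map_ofFn, List.prod_ofFn, Finset.prod_comm]
  refine Finset.prod_congr rfl fun i _ => ?_
  rw [Function.comp_apply, oneHotRandomizer, series_concatOutputs, ← List.ofFn_id, List.map_ofFn,
    List.prod_ofFn]
  rfl

/-- If in each coordinate changing the bit of one user costs a factor `E`, then the protocol with
the randomizer `oneHotRandomizer` is private with factor `E ^ 2`. -/
theorem oneHot_isPureShuffledDP {B n : ℕ} {Y : Type} (blk : Fin B → Bool → PMF (List M))
    (A : List M → PMF Y) {ε : ℝ} {E : ℝ≥0∞} (hE1 : 1 ≤ E)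
    (hE : E * E ≤ ENNReal.ofReal (Real.exp ε))
    (hblk : ∀ j b b', b ≠ b' → ∀ cs : List Bool, cs.length + 1 = n →
      series (blk j b) * (cs.map fun c => series (blk j c)).prod
        ≤ MvPowerSeries.C E * (series (blk j b') * (cs.map fun c => series (blk j c)).prod)) :
    (Protocol.mk (oneHotRandomizer blk) A).IsPureShuffledDP n ε := by
  intro x x' i hx S
  rw [ENNReal.ofReal_zero, add_zero]
  change ((concatOutputs _ _).bind shuffle).toOuterMeasure S
    ≤ _ * ((concatOutputs _ _).bind shuffle).toOuterMeasure S
  refine (toOuterMeasure_bind_shuffle_le (E := E * E) ?_ S).trans (by gcongr)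
  rw [series_oneHot, series_oneHot]
  by_cases hxi : x i = x' i
  · have hxx : x = x' := funext fun j => by
      by_cases h : j = i
      · rw [h, hxi]
      · exact hx j h
    have h1 : (1 : MvPowerSeries M ℝ≥0∞) ≤ MvPowerSeries.C (E * E) := by
      rw [← map_one MvPowerSeries.C]
      exact C_le_C (one_le_mul hE1 hE1)
    rw [hxx]
    exact le_mul_of_one_le_left zero_le h1
  -- Only the coordinates `x i` and `x' i` see a changed bit, and each costs one factor `E`.
  have hj : ∀ j, ∏ k, series (blk j (decide (j = x k)))
      ≤ ((if j = x i then MvPowerSeries.C E else 1) * (if j = x' i then MvPowerSeries.C E else 1))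
        * ∏ k, series (blk j (decide (j = x' k))) := fun j => by
    rw [← Finset.mul_prod_erase _ _ (Finset.mem_univ i),
      ← Finset.mul_prod_erase _ _ (Finset.mem_univ i)]
    have hrest : ∏ k ∈ Finset.univ.erase i, series (blk j (decide (j = x k)))
        = ∏ k ∈ Finset.univ.erase i, series (blk j (decide (j = x' k))) :=
      Finset.prod_congr rfl fun k hk => by rw [hx k (Finset.ne_of_mem_erase hk)]
    rw [hrest]
    have hlist : ∏ k ∈ Finset.univ.erase i, series (blk j (decide (j = x' k)))
        = (((Finset.univ.erase i).toList.map fun k => decide (j = x' k)).map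
            fun c => series (blk j c)).prod := by
      rw [List.map_map]
      exact (Finset.prod_map_toList _ _).symm
    rw [hlist]
    have hlen : ((Finset.univ.erase i).toList.map fun k => decide (j = x' k)).length + 1 = n := by
      have := i.pos
      simp
      omega
    have hb := fun b b' hbb => hblk j b b' hbb _ hlen
    by_cases h1 : j = x i
    · have h2 : j ≠ x' i := fun h => hxi (h1.symm.trans h)
      simpa [← h1, h2] using hb true false (by simp)
    · by_cases h2 : j = x' i
      · simpa [← h2, h1] using hb false true (by simp)
      · simp [h1, h2]
  calc ∏ j, ∏ k, series (blk j (decide (j = x k)))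
      ≤ ∏ j, (((if j = x i then MvPowerSeries.C E else 1)
          * (if j = x' i then MvPowerSeries.C E else 1))
        * ∏ k, series (blk j (decide (j = x' k)))) := Finset.prod_le_prod (fun _ _ => zero_le) fun j _ => hj j
    _ = _ := by
      rw [Finset.prod_mul_distrib, Finset.prod_mul_distrib, Finset.prod_ite_eq',
        Finset.prod_ite_eq']
      simp

end Transcript

/-! ### Noisy unary encoding of a bit -/

/-- The parameters of a law on `{0, …, 2 * center}` that is a mixture: with probability `signal` the
encoding of a bit `c`, namely `center + c`, and otherwise a value `k` that is independent of the
bit, with probability `noise * weight k`. -/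
structure BitNoise where
  signal : ℝ≥0∞
  noise : ℝ≥0∞
  weight : ℕ → ℝ≥0∞
  center : ℕ
  one_le_center : 1 ≤ center
  total : signal + noise * ∑ k ∈ Finset.range (2 * center + 1), weight k = 1

namespace BitNoise

variable (P : BitNoise)

/-- The law of the noisy encoding of the bit `c`. -/
noncomputable def law (c : Bool) : PMF ℕ :=
  PMF.ofFinset (fun k => (if k = P.center + c.toNat then P.signal else 0)
      + (if k < 2 * P.center + 1 then P.noise * P.weight k else 0))
    (Finset.range (2 * P.center + 1))
    (by
      have h1 := P.one_le_center
      have h2 : c.toNat ≤ 1 := Bool.toNat_le c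
      rw [Finset.sum_add_distrib, Finset.sum_ite_eq', if_pos (Finset.mem_range.2 (by omega)),
        Finset.sum_congr rfl fun k hk => if_pos (Finset.mem_range.1 hk), ← Finset.mul_sum, P.total])
    (fun k hk => by
      have h1 := P.one_le_center
      have h2 : c.toNat ≤ 1 := Bool.toNat_le c
      rw [Finset.mem_range] at hk
      rw [if_neg (by omega), if_neg hk, add_zero])

theorem law_apply (c : Bool) (k : ℕ) :
    P.law c k = (if k = P.center + c.toNat then P.signal else 0)
      + (if k < 2 * P.center + 1 then P.noise * P.weight k else 0) := rfl

theorem law_eq_zero (c : Bool) {k : ℕ} (hk : ¬ k < 2 * P.center + 1) : P.law c k = 0 :=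
  PMF.ofFinset_apply_of_notMem _ _ (by rwa [Finset.mem_range])

section Block

variable {M : Type} [DecidableEq M]

/-- The noisy unary encoding of the bit `c`, as a list of copies of the message `s`. -/
noncomputable def block (s : M) (c : Bool) : PMF (List M) :=
  (P.law c).map fun k => List.replicate k s

theorem series_map_replicate (p : PMF ℕ) {N : ℕ} (hp : ∀ k, ¬ k < N + 1 → p k = 0) (s : M) :
    series (p.map fun k => List.replicate k s)
      = noisePoly (fun k => MvPowerSeries.C (p k)) N (MvPowerSeries.X s) := by
  ext d
  rw [coeff_series, PMF.map_comp, PMF.map_apply,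
    tsum_eq_sum (s := Finset.range (N + 1)) fun k hk => by
      rw [hp k (by rwa [Finset.mem_range] at hk), ite_self], noisePoly, map_sum]
  refine Finset.sum_congr rfl fun k _ => ?_
  rw [MvPowerSeries.coeff_C_mul, MvPowerSeries.coeff_X_pow, Function.comp_apply,
    messageCounts_replicate]
  split_ifs <;> simp

theorem series_block (s : M) (c : Bool) :
    series (P.block s c) = MvPowerSeries.C P.signal * MvPowerSeries.X s ^ (P.center + c.toNat)
      + MvPowerSeries.C P.noise
        * noisePoly (fun k => MvPowerSeries.C (P.weight k)) (2 * P.center) (MvPowerSeries.X s) := by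
  have h1 := P.one_le_center
  have h2 : c.toNat ≤ 1 := Bool.toNat_le c
  rw [block, series_map_replicate _ (N := 2 * P.center) fun k hk => P.law_eq_zero c hk, noisePoly,
    noisePoly, Finset.mul_sum]
  simp only [law_apply, map_add, add_mul]
  rw [Finset.sum_add_distrib]
  congr 1
  · rw [Finset.sum_eq_single_of_mem (P.center + c.toNat) (Finset.mem_range.2 (by omega)), if_pos rfl]
    intro k _ hk
    rw [if_neg hk, map_zero, zero_mul]
  · refine Finset.sum_congr rfl fun k hk => ?_
    rw [if_pos (Finset.mem_range.1 hk), map_mul, mul_assoc]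

/-- Numerical conditions under which the noisy unary encodings of `n` users hide the bit of each
user, up to a factor `E`. -/
structure Hides (n : ℕ) (E e b κ : ℝ≥0∞) : Prop where
  le_succ : ∀ k < 2 * P.center, P.weight k ≤ e * P.weight (k + 1)
  succ_le : ∀ k < 2 * P.center, P.weight (k + 1) ≤ e * P.weight k
  top : ∃ i j, i ≤ 2 * P.center ∧ j ≤ 2 * P.center ∧ i + j = P.center + 1 + 2 * P.center ∧
    P.weight (2 * P.center) ≤ b * (P.weight i * P.weight j)
  bot : ∃ i j, i ≤ 2 * P.center ∧ j ≤ 2 * P.center ∧ i + j = P.center ∧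
    P.weight 0 ≤ b * (P.weight i * P.weight j)
  middle : ∀ k, P.center ≤ k + 1 → k ≤ P.center + 2 → k ≤ 2 * P.center ∧
    P.signal ≤ κ * (P.noise * P.weight k)
  factor : e + ((n - 1 : ℕ) : ℝ≥0∞)⁻¹ * κ ≤ E
  boundary : P.signal * b + P.noise ≤ E * P.noise

/-- This is `noise_swap_le` for series in one message; `top` serves the change from bit 1 to bit 0,
`bot` the reverse. -/
theorem Hides.swap_le {P : BitNoise} {n : ℕ} {E e b κ : ℝ≥0∞} (h : P.Hides n E e b κ) (hn : 2 ≤ n)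
    (s : M) {c c' : Bool} (hc : c ≠ c') (cs : List Bool) (hcs : cs.length + 1 = n) :
    series (P.block s c) * (cs.map fun c => series (P.block s c)).prod
      ≤ MvPowerSeries.C E
        * (series (P.block s c') * (cs.map fun c => series (P.block s c)).prod) := by
  have hlen : cs.length = n - 1 := by omega
  have hw : (MvPowerSeries.C ((n - 1 : ℕ) : ℝ≥0∞)⁻¹ : MvPowerSeries M ℝ≥0∞)
      * (cs.map fun c => (MvPowerSeries.X s : MvPowerSeries M ℝ≥0∞) ^ (P.center + c.toNat)).length
      = 1 := by
    rw [List.length_map, hlen,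
      ← map_natCast (MvPowerSeries.C (σ := M) (R := ℝ≥0∞)), ← map_mul, ENNReal.inv_mul_cancel,
      map_one]
    · exact Nat.cast_ne_zero.2 (by omega)
    · exact ENNReal.natCast_ne_top _
  have hκ : (MvPowerSeries.C ((n - 1 : ℕ) : ℝ≥0∞)⁻¹ : MvPowerSeries M ℝ≥0∞) * MvPowerSeries.C κ
      ≤ MvPowerSeries.C (((n - 1 : ℕ) : ℝ≥0∞)⁻¹ * κ) := by rw [map_mul]
  have hE := C_le_C (σ := M) h.factor
  have hb := C_le_C (σ := M) h.boundary
  rw [map_add] at hE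
  rw [map_add, map_mul, map_mul] at hb
  -- The signals of the changed user and of one other user are matched by the new signal and a
  -- single noise monomial, whose degree is within 2 of the center.
  have hmid : ∀ k, P.center ≤ k + 1 → k ≤ P.center + 2 → ∀ t : ℕ,
      (MvPowerSeries.C P.signal * MvPowerSeries.X s ^ (t + k) : MvPowerSeries M ℝ≥0∞)
        ≤ MvPowerSeries.C κ * (MvPowerSeries.C P.noise * (MvPowerSeries.X s ^ t
          * noisePoly (fun k => MvPowerSeries.C (P.weight k)) (2 * P.center)
            (MvPowerSeries.X s))) := fun k h1 h2 t => by
    obtain ⟨hk, hk'⟩ := h.middle k h1 h2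
    calc (MvPowerSeries.C P.signal * MvPowerSeries.X s ^ (t + k) : MvPowerSeries M ℝ≥0∞)
        ≤ MvPowerSeries.C (κ * (P.noise * P.weight k)) * MvPowerSeries.X s ^ (t + k) := by
          gcongr
          exact C_le_C hk'
      _ = MvPowerSeries.C κ * (MvPowerSeries.C P.noise * (MvPowerSeries.X s ^ t
          * (MvPowerSeries.C (P.weight k) * MvPowerSeries.X s ^ k))) := by
          rw [map_mul, map_mul]; ring
      _ ≤ _ := by
          gcongr
          exact term_le_noisePoly (fun k => MvPowerSeries.C (P.weight k)) hk _
  have hprod : (cs.map fun c => series (P.block s c))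
      = (cs.map fun c => (MvPowerSeries.X s : MvPowerSeries M ℝ≥0∞) ^ (P.center + c.toNat)).map
        fun c => MvPowerSeries.C P.signal * c + MvPowerSeries.C P.noise
        * noisePoly (fun k => MvPowerSeries.C (P.weight k)) (2 * P.center)
            (MvPowerSeries.X s) := by
    rw [List.map_map]
    exact List.map_congr_left fun c _ => P.series_block s c
  have h1 := P.one_le_center
  rw [hprod, series_block, series_block]
  obtain ⟨rfl, rfl⟩ | ⟨rfl, rfl⟩ : (c = true ∧ c' = false) ∨ (c = false ∧ c' = true) := by
    cases c <;> cases c' <;> simp_all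
  · obtain ⟨i, j, hi, hj, hij, hw'⟩ := h.top
    refine noise_swap_le _ (pow_succ_mul_noisePoly_le (e := MvPowerSeries.C e)
      (b := MvPowerSeries.C b) _ ?_ hi hj hij ?_) ?_ hw hκ hE hb
    · intro k hk
      rw [← map_mul]
      exact C_le_C (h.le_succ k hk)
    · rw [← map_mul, ← map_mul]
      exact C_le_C hw'
    · simp only [List.mem_map]
      rintro _ ⟨c, _, rfl⟩
      have h2 : c.toNat ≤ 1 := Bool.toNat_le c
      rw [← pow_add]
      convert hmid (P.center + 1 + c.toNat) (by omega) (by omega) P.center using 3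
      · simp only [Bool.toNat_true]
        omega
      · rfl
  · obtain ⟨i, j, hi, hj, hij, hw'⟩ := h.bot
    refine noise_swap_le _ (pow_mul_noisePoly_le (e := MvPowerSeries.C e)
      (b := MvPowerSeries.C b) _ ?_ hi hj hij ?_) ?_ hw hκ hE hb
    · intro k hk
      rw [← map_mul]
      exact C_le_C (h.succ_le k hk)
    · rw [← map_mul, ← map_mul]
      exact C_le_C hw'
    · simp only [List.mem_map]
      rintro _ ⟨c, _, rfl⟩
      have h2 : c.toNat ≤ 1 := Bool.toNat_le c
      rw [← pow_add]
      convert hmid (P.center - 1 + c.toNat) (by omega) (by omega) (P.center + 1) using 3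
      · simp only [Bool.toNat_false]
        omega
      · rfl

end Block

end BitNoise

/-! ### The choice of the noise -/

/-- A convex function of the distance between `k` and `2 * K`, with slope `1` up to distance `K`
and slope `2` beyond. -/
def noiseExponent (K k : ℕ) : ℕ :=
  ((k - 2 * K) + (2 * K - k)) + ((k - 2 * K) + (2 * K - k) - K)

/-- Two-sided noise centered at `2 * K`, with decay rate `θ` near the center and `2 * θ` far from
it. -/
noncomputable def noiseWeight (θ : ℝ) (K k : ℕ) : ℝ := Real.exp (-(θ * noiseExponent K k))

/-- The exponent is at least the distance to the center, so two geometric series bound the mass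
uniformly in `K`. -/
theorem sum_noiseWeight_le {θ : ℝ} (hθ : 0 < θ) (K : ℕ) :
    ∑ k ∈ Finset.range (2 * (2 * K) + 1), noiseWeight θ K k ≤ 2 * (1 - Real.exp (-θ))⁻¹ := by
  have hr0 : 0 ≤ Real.exp (-θ) := (Real.exp_pos _).le
  have hr1 : Real.exp (-θ) < 1 := Real.exp_lt_one_iff.2 (by linarith)
  have hgeom : ∀ N, ∑ i ∈ Finset.range N, Real.exp (-θ) ^ i ≤ (1 - Real.exp (-θ))⁻¹ := fun N => by
    rw [← tsum_geometric_of_lt_one hr0 hr1]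
    exact (summable_geometric_of_lt_one hr0 hr1).sum_le_tsum _ fun i _ => pow_nonneg hr0 i
  have hle : ∀ k d : ℕ, d ≤ noiseExponent K k → noiseWeight θ K k ≤ Real.exp (-θ) ^ d := by
    intro k d hd
    rw [noiseWeight, ← Real.exp_nat_mul]
    apply Real.exp_le_exp.2
    have : (d : ℝ) ≤ noiseExponent K k := by exact_mod_cast hd
    nlinarith
  rw [show 2 * (2 * K) + 1 = 2 * K + (2 * K + 1) by ring, Finset.sum_range_add,
    ← Finset.sum_range_reflect, two_mul (1 - _)⁻¹]
  refine add_le_add (le_trans (Finset.sum_le_sum fun i hi => ?_) (hgeom (2 * K)))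
    (le_trans (Finset.sum_le_sum fun i _ => ?_) (hgeom (2 * K + 1)))
  · have := Finset.mem_range.1 hi
    exact hle _ i (by unfold noiseExponent; omega)
  · exact hle _ i (by unfold noiseExponent; omega)

theorem noiseWeight_pos (θ : ℝ) (K k : ℕ) : 0 < noiseWeight θ K k := Real.exp_pos _

/-- The encoding in which a user contributes noise of the law `noiseWeight` with weight `l` against
weight `n` for the true bit. -/
noncomputable def laplaceNoise (θ l : ℝ) (n K : ℕ) (hl : 0 < l) (hn : 0 < n) (hK : 1 ≤ K) :
    BitNoise where
  signal := ENNReal.ofReal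
    (n / (n + l * ∑ k ∈ Finset.range (2 * (2 * K) + 1), noiseWeight θ K k))
  noise := ENNReal.ofReal
    (l / (n + l * ∑ k ∈ Finset.range (2 * (2 * K) + 1), noiseWeight θ K k))
  weight k := ENNReal.ofReal (noiseWeight θ K k)
  center := 2 * K
  one_le_center := by omega
  total := by
    have hG : 0 ≤ ∑ k ∈ Finset.range (2 * (2 * K) + 1), noiseWeight θ K k :=
      Finset.sum_nonneg fun k _ => (noiseWeight_pos θ K k).le
    rw [← ENNReal.ofReal_sum_of_nonneg fun k _ => (noiseWeight_pos θ K k).le]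
    generalize ∑ k ∈ Finset.range (2 * (2 * K) + 1), noiseWeight θ K k = G at *
    have hD : 0 < n + l * G := by positivity
    rw [← ENNReal.ofReal_mul (by positivity), ← ENNReal.ofReal_add (by positivity) (by positivity),
      ← ENNReal.ofReal_one]
    congr 1
    field_simp

theorem noise_mass_le {θ l : ℝ} {n K : ℕ} (hθ : 0 < θ) (hl : 0 < l) (hn : 0 < n) (hK : 1 ≤ K) :
    (laplaceNoise θ l n K hl hn hK).noise
        * ∑ k ∈ Finset.range (2 * (laplaceNoise θ l n K hl hn hK).center + 1),
            (laplaceNoise θ l n K hl hn hK).weight k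
      ≤ ENNReal.ofReal (l * (2 * (1 - Real.exp (-θ))⁻¹) / n) := by
  have hG : 0 ≤ ∑ k ∈ Finset.range (2 * (2 * K) + 1), noiseWeight θ K k :=
    Finset.sum_nonneg fun k _ => (noiseWeight_pos θ K k).le
  have hG' := sum_noiseWeight_le hθ K
  simp only [laplaceNoise]
  rw [← ENNReal.ofReal_sum_of_nonneg fun k _ => (noiseWeight_pos θ K k).le]
  generalize ∑ k ∈ Finset.range (2 * (2 * K) + 1), noiseWeight θ K k = G at *
  have hn' : (0 : ℝ) < n := Nat.cast_pos.2 hn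
  rw [← ENNReal.ofReal_mul (by positivity)]
  apply ENNReal.ofReal_le_ofReal
  rw [div_mul_eq_mul_div]
  have hlG : 0 ≤ l * G := by positivity
  exact div_le_div₀ (hlG.trans (mul_le_mul_of_nonneg_left hG' hl.le))
    (mul_le_mul_of_nonneg_left hG' hl.le) hn' (by linarith)

/-- The rate `a / 4` is chosen because neighbouring exponents differ by at most 2, which costs `exp
(a / 2)`, and exponents near the center are at most 4, which costs `exp a`. `hl1` fits the
all-signal term into the remaining gap; `hl2` and `hKn` handle the ends. -/
theorem laplaceNoise_hides {a l : ℝ} {n K : ℕ} (ha : 0 < a) (hl : 0 < l) (hn : 2 ≤ n)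
    (hK : 1 ≤ K) (hl1 : 2 * Real.exp a ≤ l * (Real.exp a - Real.exp (a / 2)))
    (hl2 : 1 ≤ l * (Real.exp a - 1)) (hKn : Real.log n ≤ a / 4 * ((K : ℝ) - 2)) :
    (laplaceNoise (a / 4) l n K hl (by omega) hK).Hides n (ENNReal.ofReal (Real.exp a))
      (ENNReal.ofReal (Real.exp (a / 2))) (ENNReal.ofReal (Real.exp (-(a / 4 * ((K : ℝ) - 2)))))
      (ENNReal.ofReal (n * Real.exp a / l)) := by
  have hθ : 0 < a / 4 := by positivity
  have hn' : (2 : ℝ) ≤ n := by exact_mod_cast hn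
  have hstep : ∀ k k', noiseExponent K k' ≤ noiseExponent K k + 2 →
      ENNReal.ofReal (noiseWeight (a / 4) K k)
        ≤ ENNReal.ofReal (Real.exp (a / 2)) * ENNReal.ofReal (noiseWeight (a / 4) K k') := by
    intro k k' h
    rw [← ENNReal.ofReal_mul (Real.exp_pos _).le]
    apply ENNReal.ofReal_le_ofReal
    rw [noiseWeight, noiseWeight, ← Real.exp_add]
    apply Real.exp_le_exp.2
    have : (noiseExponent K k' : ℝ) ≤ noiseExponent K k + 2 := by exact_mod_cast h
    nlinarith
  have hends : ∀ k i j, noiseExponent K i + noiseExponent K j + K ≤ noiseExponent K k + 2 →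
      ENNReal.ofReal (noiseWeight (a / 4) K k)
        ≤ ENNReal.ofReal (Real.exp (-(a / 4 * ((K : ℝ) - 2))))
          * (ENNReal.ofReal (noiseWeight (a / 4) K i)
            * ENNReal.ofReal (noiseWeight (a / 4) K j)) := by
    intro k i j h
    rw [← ENNReal.ofReal_mul (noiseWeight_pos _ _ _).le, ← ENNReal.ofReal_mul (Real.exp_pos _).le]
    apply ENNReal.ofReal_le_ofReal
    rw [noiseWeight, noiseWeight, noiseWeight, ← Real.exp_add, ← Real.exp_add]
    apply Real.exp_le_exp.2
    have : (noiseExponent K i : ℝ) + noiseExponent K j + K ≤ noiseExponent K k + 2 := by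
      exact_mod_cast h
    nlinarith
  have hG : 0 ≤ ∑ k ∈ Finset.range (2 * (2 * K) + 1), noiseWeight (a / 4) K k :=
    Finset.sum_nonneg fun k _ => (noiseWeight_pos _ K k).le
  constructor
  all_goals try simp only [laplaceNoise]
  · intro k _
    exact hstep _ _ (by unfold noiseExponent; omega)
  · intro k _
    exact hstep _ _ (by unfold noiseExponent; omega)
  -- The end has exponent `3 * K`, the witnesses `K` and `K + 2`. The gain of `K - 2` comes from the
  -- slope 2 in the tails.
  · exact ⟨3 * K, 3 * K + 1, by omega, by omega, by omega,
      hends _ _ _ (by unfold noiseExponent; omega)⟩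
  · exact ⟨K, K, by omega, by omega, by omega, hends _ _ _ (by unfold noiseExponent; omega)⟩
  · intro k h1 h2
    refine ⟨by omega, ?_⟩
    generalize ∑ k ∈ Finset.range (2 * (2 * K) + 1), noiseWeight (a / 4) K k = G at *
    have hD : 0 < n + l * G := by positivity
    rw [← ENNReal.ofReal_mul (by positivity), ← ENNReal.ofReal_mul (by positivity)]
    apply ENNReal.ofReal_le_ofReal
    have hw : Real.exp (-a) ≤ noiseWeight (a / 4) K k := by
      apply Real.exp_le_exp.2
      have h : noiseExponent K k ≤ 4 := by unfold noiseExponent; omega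
      have : (noiseExponent K k : ℝ) ≤ 4 := by exact_mod_cast h
      nlinarith
    calc n / (n + l * G) = n * Real.exp a / l * (l / (n + l * G) * Real.exp (-a)) := by
          rw [Real.exp_neg]; field_simp
      _ ≤ _ := by gcongr
  · rw [← ENNReal.ofReal_natCast, ← ENNReal.ofReal_inv_of_pos (by
      exact_mod_cast (by omega : 0 < n - 1)), ← ENNReal.ofReal_mul (by positivity),
      ← ENNReal.ofReal_add (by positivity) (by positivity)]
    apply ENNReal.ofReal_le_ofReal
    rw [Nat.cast_sub (by omega), Nat.cast_one]
    have h1 : (0 : ℝ) < n - 1 := by linarith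
    -- This is n / (n - 1) ≤ 2.
    have h2 : ((n : ℝ) - 1)⁻¹ * (n * Real.exp a / l) ≤ 2 * Real.exp a / l := by
      rw [← div_eq_inv_mul, div_div, div_le_div_iff₀ (by positivity) hl]
      nlinarith [mul_pos hl (Real.exp_pos a)]
    have h3 : 2 * Real.exp a / l ≤ Real.exp a - Real.exp (a / 2) := by
      rw [div_le_iff₀ hl]; linarith
    linarith
  · generalize ∑ k ∈ Finset.range (2 * (2 * K) + 1), noiseWeight (a / 4) K k = G at *
    have hD : 0 < n + l * G := by positivity
    rw [← ENNReal.ofReal_mul (by positivity), ← ENNReal.ofReal_mul (by positivity),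
      ← ENNReal.ofReal_add (by positivity) (by positivity)]
    apply ENNReal.ofReal_le_ofReal
    -- `b` is at most 1/n, which cancels the n in the ratio n / l of signal to noise.
    have h1 : n * Real.exp (-(a / 4 * ((K : ℝ) - 2))) ≤ 1 := by
      rw [← Real.exp_log (show (0 : ℝ) < n by linarith), ← Real.exp_add, Real.exp_le_one_iff]
      linarith
    rw [div_mul_eq_mul_div, ← add_div, mul_div_assoc']
    gcongr
    linarith

theorem exists_bitNoise {a : ℝ} (ha : 0 < a) :
    ∃ C L : ℝ, 0 < C ∧ 0 < L ∧ ∀ n : ℕ, 2 ≤ n → ∃ (P : BitNoise) (e b κ : ℝ≥0∞),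
      P.Hides n (ENNReal.ofReal (Real.exp a)) e b κ ∧
      (P.center : ℝ) + 1 ≤ C * Real.log n ∧
      P.noise * ∑ k ∈ Finset.range (2 * P.center + 1), P.weight k ≤ ENNReal.ofReal (L / n) := by
  have h1 : 0 < Real.exp a - Real.exp (a / 2) := sub_pos.2 (Real.exp_lt_exp.2 (by linarith))
  have h2 : 0 < Real.exp a - 1 := sub_pos.2 (Real.one_lt_exp_iff.2 ha)
  have h3 : 0 < 1 - Real.exp (-(a / 4)) := sub_pos.2 (Real.exp_lt_one_iff.2 (by linarith))
  have hlog2 : 0 < Real.log 2 := Real.log_pos (by norm_num)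
  obtain ⟨l, hl, hl1, hl2⟩ : ∃ l : ℝ, 0 < l ∧
      2 * Real.exp a ≤ l * (Real.exp a - Real.exp (a / 2)) ∧ 1 ≤ l * (Real.exp a - 1) := by
    -- The sum of the two lower bounds on `l` meets both.
    refine ⟨2 * Real.exp a / (Real.exp a - Real.exp (a / 2)) + 1 / (Real.exp a - 1),
      by positivity, ?_, ?_⟩
    · rw [add_mul, div_mul_cancel₀ _ h1.ne']
      exact le_add_of_nonneg_right (by positivity)
    · rw [add_mul, div_mul_cancel₀ _ h2.ne']
      exact le_add_of_nonneg_left (by positivity)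
  refine ⟨8 / a + 7 / Real.log 2, l * (2 * (1 - Real.exp (-(a / 4)))⁻¹), by positivity,
    by positivity, fun n hn => ?_⟩
  have hn' : (2 : ℝ) ≤ n := by exact_mod_cast hn
  have hlog : Real.log 2 ≤ Real.log n := Real.log_le_log (by norm_num) hn'
  have hK : 1 ≤ ⌈4 / a * Real.log n⌉₊ + 2 := by omega
  refine ⟨laplaceNoise (a / 4) l n (⌈4 / a * Real.log n⌉₊ + 2) hl (by omega) hK, _, _, _,
    laplaceNoise_hides ha hl hn hK hl1 hl2 ?_, ?_, noise_mass_le (by positivity) hl _ hK⟩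
  · have := Nat.le_ceil (4 / a * Real.log n)
    push_cast
    calc Real.log n = a / 4 * (4 / a * Real.log n) := by field_simp
      _ ≤ _ := by gcongr; linarith
  -- Here center + 1 is twice the ceiling plus 5, hence below 8 / a * log n + 7; the 7 is absorbed
  -- by log n ≥ log 2.
  · have h4 := Nat.ceil_lt_add_one (show 0 ≤ 4 / a * Real.log n by positivity)
    have h5 : 7 ≤ 7 / Real.log 2 * Real.log n := by
      rw [div_mul_eq_mul_div, le_div_iff₀ hlog2]; linarith
    have h6 : 8 / a * Real.log n = 2 * (4 / a * Real.log n) := by ring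
    simp only [laplaceNoise]
    push_cast
    linarith

/-! ### Expectations -/

section Expect

variable {α β : Type}

/-- The expectation of a nonnegative function. -/
noncomputable def expect (μ : PMF α) (f : α → ℝ≥0∞) : ℝ≥0∞ := ∑' a, μ a * f a

theorem expect_mono (μ : PMF α) {f g : α → ℝ≥0∞} (h : ∀ a, f a ≤ g a) :
    expect μ f ≤ expect μ g :=
  ENNReal.tsum_le_tsum fun a => mul_le_mul_right (h a) _

theorem expect_const (μ : PMF α) (c : ℝ≥0∞) : expect μ (fun _ => c) = c := by
  rw [expect, ENNReal.tsum_mul_right, μ.tsum_coe, one_mul]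

theorem expect_const_mul (μ : PMF α) (c : ℝ≥0∞) (f : α → ℝ≥0∞) :
    expect μ (fun a => c * f a) = c * expect μ f := by
  rw [expect, expect, ← ENNReal.tsum_mul_left]
  exact tsum_congr fun a => by ring

theorem expect_add (μ : PMF α) (f g : α → ℝ≥0∞) :
    expect μ (fun a => f a + g a) = expect μ f + expect μ g := by
  simp only [expect, mul_add]
  exact ENNReal.tsum_add

theorem expect_sum {ι : Type} (s : Finset ι) (μ : PMF α) (f : ι → α → ℝ≥0∞) :
    expect μ (fun a => ∑ i ∈ s, f i a) = ∑ i ∈ s, expect μ (f i) := by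
  simp only [expect, Finset.mul_sum]
  exact Summable.tsum_finsetSum fun i _ => ENNReal.summable

theorem expect_bind (μ : PMF α) (κ : α → PMF β) (f : β → ℝ≥0∞) :
    expect (μ.bind κ) f = expect μ fun a => expect (κ a) f := by
  simp only [expect, PMF.bind_apply, ← ENNReal.tsum_mul_right, ← ENNReal.tsum_mul_left]
  rw [ENNReal.tsum_comm]
  exact tsum_congr fun a => tsum_congr fun b => by ring

theorem expect_pure (a : α) (f : α → ℝ≥0∞) : expect (PMF.pure a) f = f a := by
  classical
  rw [expect, tsum_eq_single a fun b hb => by rw [PMF.pure_apply_of_ne _ _ hb, zero_mul],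
    PMF.pure_apply_self, one_mul]

theorem expect_map (μ : PMF α) (φ : α → β) (f : β → ℝ≥0∞) :
    expect (μ.map φ) f = expect μ fun a => f (φ a) := by
  rw [PMF.map, expect_bind]
  simp only [Function.comp_apply, expect_pure]

theorem expect_shuffle {M : Type} (l : List M) {f : List M → ℝ≥0∞}
    (hf : ∀ l', l'.Perm l → f l' = f l) : expect (shuffle l) f = f l := by
  rw [shuffle, expect_map]
  have : ∀ σ : Equiv.Perm (Fin l.length), f (List.ofFn fun i => l.get (σ i)) = f l := fun σ => by
    apply hf
    have := Equiv.Perm.ofFn_comp_perm σ l.get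
    rwa [List.ofFn_get] at this
  simp only [this, expect_const]

end Expect

/-! ### Exponential moments of the message counts -/

section Deviation

variable {M : Type} [DecidableEq M]

/-- The exponential of `t` times the deviation of the number of messages `s` from `c`. -/
noncomputable def expDev (t : ℝ) (s : M) (c : ℝ) (l : List M) : ℝ≥0∞ :=
  ENNReal.ofReal (Real.exp (t * |(l.count s : ℝ) - c|))

theorem expDev_append {t : ℝ} (ht : 0 ≤ t) (s : M) (c d : ℝ) (u v : List M) :
    expDev t s (c + d) (u ++ v) ≤ expDev t s c u * expDev t s d v := by
  rw [expDev, expDev, expDev, ← ENNReal.ofReal_mul (Real.exp_pos _).le, ← Real.exp_add, ← mul_add]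
  apply ENNReal.ofReal_le_ofReal
  gcongr
  rw [List.count_append, Nat.cast_add, add_sub_add_comm]
  exact abs_add_le _ _

/-- By the triangle inequality `expDev` is submultiplicative, and independence factors the
expectation. -/
theorem expect_expDev_concatOutputs_le {X : Type} {t : ℝ} (ht : 0 ≤ t) (s : M) (c : X → ℝ)
    (R : X → PMF (List M)) (xs : List X) :
    expect (concatOutputs R xs) (expDev t s (xs.map c).sum)
      ≤ (xs.map fun x => expect (R x) (expDev t s (c x))).prod := by
  induction xs with
  | nil => simp [concatOutputs, expect_pure, expDev]
  | cons x xs ih =>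
    simp only [concatOutputs, List.map_cons, List.sum_cons, List.prod_cons, expect_bind, expect_map]
    calc expect (R x) (fun u => expect (concatOutputs R xs)
            fun v => expDev t s (c x + (xs.map c).sum) (u ++ v))
        ≤ expect (R x) (fun u => expect (concatOutputs R xs)
            fun v => expDev t s (c x) u * expDev t s (xs.map c).sum v) :=
          expect_mono _ fun u => expect_mono _ fun v => expDev_append ht s _ _ u v
      _ = expect (concatOutputs R xs) (expDev t s (xs.map c).sum)
            * expect (R x) (expDev t s (c x)) := by
          simp only [expect_const_mul]
          rw [← expect_const_mul]
          simp only [mul_comm]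
      _ ≤ _ := by
          rw [mul_comm]
          gcongr

/-- A signal has no deviation; noise deviates by at most `center + 1`, so at this rate the exponent
is at most 1. -/
theorem BitNoise.expect_expDev_block_le (P : BitNoise) (s : M) (c : Bool) :
    expect (P.block s c) (expDev ((P.center : ℝ) + 1)⁻¹ s (P.center + c.toNat))
      ≤ 1 + (P.noise * ∑ k ∈ Finset.range (2 * P.center + 1), P.weight k)
        * ENNReal.ofReal (Real.exp 1) := by
  have h1 := P.one_le_center
  have h2 : c.toNat ≤ 1 := Bool.toNat_le c
  rw [BitNoise.block, expect_map, expect,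
    tsum_eq_sum (s := Finset.range (2 * P.center + 1)) fun k hk => by
      rw [P.law_eq_zero c (by rwa [Finset.mem_range] at hk), zero_mul]]
  simp only [BitNoise.law_apply, add_mul]
  rw [Finset.sum_add_distrib]
  refine add_le_add ?_ ?_
  · rw [Finset.sum_eq_single_of_mem (P.center + c.toNat) (Finset.mem_range.2 (by omega))]
    · rw [if_pos rfl, expDev, List.count_replicate_self]
      simp only [Nat.cast_add, sub_self, abs_zero, mul_zero, Real.exp_zero, ENNReal.ofReal_one,
        mul_one]
      exact le_self_add.trans_eq P.total
    · intro k _ hk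
      rw [if_neg hk, zero_mul]
  · rw [Finset.mul_sum, Finset.sum_mul]
    refine Finset.sum_le_sum fun k hk => ?_
    have hk' := Finset.mem_range.1 hk
    rw [if_pos hk', expDev, List.count_replicate_self]
    gcongr
    rw [inv_mul_le_iff₀ (by positivity), mul_one, abs_le]
    have h3 : (c.toNat : ℝ) ≤ 1 := by exact_mod_cast h2
    have h4 : (k : ℝ) ≤ 2 * P.center := by exact_mod_cast Nat.lt_succ_iff.1 hk'
    have h5 : (0 : ℝ) ≤ k := Nat.cast_nonneg k
    have h6 : (0 : ℝ) ≤ c.toNat := Nat.cast_nonneg _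
    constructor <;> linarith

theorem BitNoise.expect_expDev_block_of_ne (P : BitNoise) (t : ℝ) {s s' : M} (h : s' ≠ s)
    (c : Bool) : expect (P.block s' c) (expDev t s 0) = 1 := by
  rw [BitNoise.block, expect_map]
  simp [expDev, List.count_replicate, h, expect_const]

end Deviation

/-! ### The histogram protocol -/

section Histogram

variable {M : Type} [DecidableEq M] {B : ℕ}

/-- The protocol in which each user sends noisy unary encodings of the coordinates of the one-hot
encoding of its input, and the analyzer counts the messages of each kind. -/
noncomputable def histogramProtocol (P : BitNoise) (n : ℕ) (msg : Fin B → M) :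
    Protocol (Fin B) M (Fin B → ℝ) where
  randomizer := oneHotRandomizer fun j => P.block (msg j)
  analyzer l := PMF.pure fun j => (l.count (msg j) : ℝ) - n * P.center

theorem histogramProtocol_isPureShuffledDP {P : BitNoise} {n : ℕ} {ε : ℝ} {e b κ : ℝ≥0∞}
    (msg : Fin B → M) (hn : 2 ≤ n) (hε : 0 < ε)
    (h : P.Hides n (ENNReal.ofReal (Real.exp (ε / 2))) e b κ) :
    (histogramProtocol P n msg).IsPureShuffledDP n ε := by
  refine oneHot_isPureShuffledDP _ _ (E := ENNReal.ofReal (Real.exp (ε / 2))) ?_ ?_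
    fun j b b' hb cs hcs => h.swap_le hn (msg j) hb cs hcs
  · rw [ENNReal.one_le_ofReal]
    exact Real.one_le_exp (by linarith)
  · rw [← ENNReal.ofReal_mul (Real.exp_pos _).le, ← Real.exp_add, add_halves]

omit [DecidableEq M] in
theorem length_le_of_mem_support_concatOutputs {X : Type} {R : X → PMF (List M)} {N : ℕ}
    (hR : ∀ x, ∀ u ∈ (R x).support, u.length ≤ N) (xs : List X) :
    ∀ u ∈ (concatOutputs R xs).support, u.length ≤ xs.length * N := by
  induction xs with
  | nil => simp [concatOutputs]
  | cons x xs ih =>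
    intro w hw
    rw [concatOutputs, PMF.mem_support_bind_iff] at hw
    obtain ⟨u, hu, hw⟩ := hw
    obtain ⟨v, hv, rfl⟩ := (PMF.mem_support_map_iff _ _ _).1 hw
    have h1 := hR x u hu
    have h2 := ih v hv
    simp only [List.length_append, List.length_cons]
    linarith

theorem histogramProtocol_sendsAtMost (P : BitNoise) (n : ℕ) (msg : Fin B → M) :
    (histogramProtocol P n msg).SendsAtMost ((B * (2 * P.center) : ℕ) : ℝ) := by
  intro x u hu
  have := length_le_of_mem_support_concatOutputs (N := 2 * P.center) (fun j u hu => ?_) _ u hu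
  · rw [List.length_finRange] at this
    exact_mod_cast this
  · obtain ⟨k, hk, rfl⟩ := (PMF.mem_support_map_iff _ _ _).1 hu
    rw [List.length_replicate]
    by_contra hlt
    exact hk (P.law_eq_zero _ (by omega))

theorem expectedError_histogramProtocol (P : BitNoise) {n : ℕ} (msg : Fin B → M)
    (x : Fin n → Fin B) :
    expectedError (histogramProtocol P n msg) x
      = expect (concatOutputs (histogramProtocol P n msg).randomizer (List.ofFn x)) fun l =>
        ENNReal.ofReal ‖(fun j => (l.count (msg j) : ℝ) - n * P.center) - histogram x‖ := by
  change expect (((concatOutputs _ _).bind shuffle).bind _) _ = _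
  rw [expect_bind, expect_bind]
  congr 1
  funext l
  simp only [histogramProtocol, expect_pure]
  exact expect_shuffle l fun l' hl' => by simp only [hl'.count_eq]

/-- By injectivity of `msg`, only block `j` of each user affects the count of `msg j`. -/
theorem expect_expDev_histogram_le (P : BitNoise) {n : ℕ} {msg : Fin B → M}
    (hmsg : Function.Injective msg) (x : Fin n → Fin B) (j : Fin B) {Q : ℝ≥0∞}
    (hQ : 1 + (P.noise * ∑ k ∈ Finset.range (2 * P.center + 1), P.weight k)
        * ENNReal.ofReal (Real.exp 1) ≤ Q) :
    expect (concatOutputs (histogramProtocol P n msg).randomizer (List.ofFn x))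
      (expDev ((P.center : ℝ) + 1)⁻¹ (msg j) (n * P.center + histogram x j)) ≤ Q ^ n := by
  have ht : 0 ≤ ((P.center : ℝ) + 1)⁻¹ := by positivity
  have huser : ∀ y : Fin B, expect ((histogramProtocol P n msg).randomizer y)
      (expDev ((P.center : ℝ) + 1)⁻¹ (msg j) (P.center + if y = j then 1 else 0)) ≤ Q := by
    intro y
    have h := expect_expDev_concatOutputs_le ht (msg j)
      (fun i => if i = j then (P.center : ℝ) + if y = j then 1 else 0 else 0)
      (fun i => P.block (msg i) (decide (i = y))) (List.finRange B)
    rw [← List.ofFn_id, List.map_ofFn, List.map_ofFn, List.sum_ofFn, List.prod_ofFn] at h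
    simp only [Function.comp_apply, id_eq, Finset.sum_ite_eq', Finset.mem_univ, if_true] at h
    rw [List.ofFn_id] at h
    refine h.trans ?_
    rw [Finset.prod_eq_single_of_mem j (Finset.mem_univ j)]
    · refine le_trans ?_ ((P.expect_expDev_block_le (msg j) (decide (j = y))).trans hQ)
      rw [if_pos rfl]
      by_cases hy : y = j
      · simp [hy]
      · simp [hy, Ne.symm hy]
    · intro i _ hi
      rw [if_neg hi]
      exact P.expect_expDev_block_of_ne _ (hmsg.ne hi) _
  have h := expect_expDev_concatOutputs_le ht (msg j)
    (fun y => (P.center : ℝ) + if y = j then 1 else 0)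
    (histogramProtocol P n msg).randomizer (List.ofFn x)
  rw [List.map_ofFn, List.map_ofFn, List.sum_ofFn, List.prod_ofFn] at h
  have hsum : ∑ i, ((fun y => (P.center : ℝ) + if y = j then 1 else 0) ∘ x) i
      = n * P.center + histogram x j := by
    simp [Finset.sum_add_distrib, histogram]
  rw [hsum] at h
  refine h.trans ((Finset.prod_le_prod' fun i _ => huser (x i)).trans_eq ?_)
  simp

/-- A soft maximum: `1 + u ≤ exp u` at `u = |z j| / r - log B`, with the single term then bounded by
the sum. -/
theorem norm_le_log_add_exp {z : Fin B → ℝ} {r : ℝ} (hr : 0 < r) (hB : 1 ≤ B) :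
    ‖z‖ ≤ r * (Real.log B + ∑ j, (B : ℝ)⁻¹ * Real.exp (r⁻¹ * |z j|)) := by
  have hB' : (0 : ℝ) < B := by exact_mod_cast hB
  have hlog : 0 ≤ Real.log B := Real.log_natCast_nonneg B
  refine (pi_norm_le_iff_of_nonneg (by positivity)).2 fun j => ?_
  have h1 : r⁻¹ * |z j| - Real.log B ≤ (B : ℝ)⁻¹ * Real.exp (r⁻¹ * |z j|) := by
    have := Real.add_one_le_exp (r⁻¹ * |z j| - Real.log B)
    rw [Real.exp_sub, Real.exp_log hB', div_eq_inv_mul] at this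
    linarith
  have h2 : (B : ℝ)⁻¹ * Real.exp (r⁻¹ * |z j|) ≤ ∑ j, (B : ℝ)⁻¹ * Real.exp (r⁻¹ * |z j|) :=
    Finset.single_le_sum (f := fun j => (B : ℝ)⁻¹ * Real.exp (r⁻¹ * |z j|))
      (fun i _ => by positivity) (Finset.mem_univ j)
  rw [Real.norm_eq_abs, ← inv_mul_le_iff₀ hr]
  linarith

theorem histogramProtocol_expectedError_le (P : BitNoise) {n : ℕ} {msg : Fin B → M}
    (hmsg : Function.Injective msg) (hB : 1 ≤ B) (hn : 0 < n) {L : ℝ} (hL : 0 ≤ L)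
    (hP : P.noise * ∑ k ∈ Finset.range (2 * P.center + 1), P.weight k ≤ ENNReal.ofReal (L / n))
    (x : Fin n → Fin B) :
    expectedError (histogramProtocol P n msg) x
      ≤ ENNReal.ofReal ((P.center + 1) * (Real.log B + Real.exp (L * Real.exp 1))) := by
  have hB' : (0 : ℝ) < B := by exact_mod_cast hB
  have hn' : (0 : ℝ) < n := by exact_mod_cast hn
  have hlog : 0 ≤ Real.log B := Real.log_natCast_nonneg B
  -- In this form the n-th power is `exp (L * exp 1)`, free of n.
  have hQ : 1 + (P.noise * ∑ k ∈ Finset.range (2 * P.center + 1), P.weight k)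
      * ENNReal.ofReal (Real.exp 1) ≤ ENNReal.ofReal (Real.exp (L * Real.exp 1 / n)) := by
    calc _ ≤ 1 + ENNReal.ofReal (L / n) * ENNReal.ofReal (Real.exp 1) := by gcongr
      _ = ENNReal.ofReal (L * Real.exp 1 / n + 1) := by
        rw [← ENNReal.ofReal_mul (by positivity), ← ENNReal.ofReal_one,
          ← ENNReal.ofReal_add zero_le_one (by positivity)]
        congr 1
        ring
      _ ≤ _ := ENNReal.ofReal_le_ofReal (Real.add_one_le_exp _)
  have hdev := fun j => expect_expDev_histogram_le P hmsg x j hQ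
  rw [← ENNReal.ofReal_pow (Real.exp_pos _).le, ← Real.exp_nat_mul,
    mul_div_cancel₀ _ hn'.ne'] at hdev
  rw [expectedError_histogramProtocol]
  generalize concatOutputs (histogramProtocol P n msg).randomizer (List.ofFn x) = μ at hdev ⊢
  calc _ ≤ expect μ fun l => ENNReal.ofReal (P.center + 1) * (ENNReal.ofReal (Real.log B)
          + ∑ j, ENNReal.ofReal (B : ℝ)⁻¹ * expDev ((P.center : ℝ) + 1)⁻¹ (msg j)
              (n * P.center + histogram x j) l) := by
        refine expect_mono _ fun l => ?_
        refine (ENNReal.ofReal_le_ofReal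
          (norm_le_log_add_exp (r := (P.center : ℝ) + 1) (by positivity) hB)).trans_eq ?_
        rw [ENNReal.ofReal_mul (by positivity), ENNReal.ofReal_add hlog
          (Finset.sum_nonneg fun j _ => by positivity),
          ENNReal.ofReal_sum_of_nonneg fun j _ => by positivity]
        simp only [expDev, ENNReal.ofReal_mul (inv_nonneg.2 hB'.le), Pi.sub_apply, sub_sub]
    _ = ENNReal.ofReal (P.center + 1) * (ENNReal.ofReal (Real.log B)
          + ∑ j, ENNReal.ofReal (B : ℝ)⁻¹ * expect μ (expDev ((P.center : ℝ) + 1)⁻¹ (msg j)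
              (n * P.center + histogram x j))) := by
        rw [expect_const_mul, expect_add, expect_const, expect_sum]
        simp only [expect_const_mul]
    _ ≤ ENNReal.ofReal (P.center + 1) * (ENNReal.ofReal (Real.log B)
          + ∑ _j : Fin B, ENNReal.ofReal (B : ℝ)⁻¹
              * ENNReal.ofReal (Real.exp (L * Real.exp 1))) := by
        gcongr with j
        exact hdev j
    _ = _ := by
        rw [Finset.sum_const, Finset.card_univ, Fintype.card_fin, nsmul_eq_mul,
          ← ENNReal.ofReal_natCast, ← ENNReal.ofReal_mul (by positivity),
          ← ENNReal.ofReal_mul (by positivity), ← ENNReal.ofReal_add hlog (by positivity),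
          ← ENNReal.ofReal_mul (by positivity)]
        congr 3
        field_simp

/-- Over a domain with one element, the histogram is known without any message. -/
noncomputable def trivialProtocol (n : ℕ) : Protocol (Fin B) M (Fin B → ℝ) where
  randomizer _ := PMF.pure []
  analyzer _ := PMF.pure fun _ => n

omit [DecidableEq M] in
theorem trivialProtocol_transcript (m n : ℕ) (x : Fin n → Fin B) :
    (trivialProtocol (M := M) (B := B) m).transcript x = PMF.pure [] := by
  have h : ∀ xs : List (Fin B),
      concatOutputs (trivialProtocol (M := M) (B := B) m).randomizer xs = PMF.pure [] := by
    intro xs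
    induction xs with
    | nil => rfl
    | cons y ys ih => rw [concatOutputs, ih]; simp [trivialProtocol, PMF.pure_map]
  rw [Protocol.transcript, h, PMF.pure_bind, shuffle]
  simp only [List.length_nil, List.ofFn_zero]
  exact PMF.map_const _ _

omit [DecidableEq M] in
theorem trivialProtocol_isPureShuffledDP (m n : ℕ) {ε : ℝ} (hε : 0 < ε) :
    (trivialProtocol (M := M) (B := B) m).IsPureShuffledDP n ε := by
  intro x x' i _ S
  simp only [trivialProtocol_transcript, ENNReal.ofReal_zero, add_zero]
  exact le_mul_of_one_le_left zero_le (ENNReal.one_le_ofReal.2 (Real.one_le_exp hε.le))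

omit [DecidableEq M] in
theorem trivialProtocol_expectedError {n : ℕ} (x : Fin n → Fin 1) :
    expectedError (trivialProtocol (M := M) n) x = 0 := by
  have hx : histogram x = fun _ => (n : ℝ) := funext fun j => by
    simp [histogram, Subsingleton.elim _ j]
  change expect (((trivialProtocol n).transcript x).bind _) _ = 0
  rw [trivialProtocol_transcript, PMF.pure_bind]
  simp [trivialProtocol, expect_pure, hx]

end Histogram

end ShuffledDP

/-! ### Assembly and constants -/

theorem corollaryA1 :
    -- the constant in the message length is absolute, the other two depend on `ε` only
    ∃ c : ℝ, 0 < c ∧ ∀ ε : ℝ, 0 < ε → ∃ C₁ C₂ : ℝ, 0 < C₁ ∧ 0 < C₂ ∧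
      ∀ B n : ℕ, 1 ≤ B → 2 ≤ n →
        ∃ ℓ : ℕ, (ℓ : ℝ) ≤ c * Real.log B ∧
          ∃ P : ShuffledDP.Protocol (Fin B) (BitVec ℓ) (Fin B → ℝ),
            P.IsPureShuffledDP n ε ∧
            (∀ x : Fin n → Fin B, ShuffledDP.expectedError P x
              ≤ ENNReal.ofReal (C₁ * (Real.log B * Real.log n))) ∧
            P.SendsAtMost (C₂ * (B * Real.log n)) := by
  open ShuffledDP in
  have hlog2 : 0 < Real.log 2 := Real.log_pos (by norm_num)
  refine ⟨2 / Real.log 2, by positivity, fun ε hε => ?_⟩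
  -- Half of `ε` for each of the two coordinates that a change of input affects.
  obtain ⟨C, L, hC, hL, hP⟩ := exists_bitNoise (half_pos hε)
  refine ⟨C * (1 + Real.exp (L * Real.exp 1) / Real.log 2), 2 * C, by positivity, by positivity,
    fun B n hB hn => ?_⟩
  have hn' : (2 : ℝ) ≤ n := by exact_mod_cast hn
  have hlogn : 0 < Real.log n := Real.log_pos (by linarith)
  -- For B = 1 the bounds on error and message length are both 0, so an exact protocol with empty
  -- messages is needed.
  obtain rfl | hB2 := hB.eq_or_lt
  · refine ⟨0, by simp, trivialProtocol n, trivialProtocol_isPureShuffledDP n n hε, fun x => ?_,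
      fun x u hu => ?_⟩
    · rw [trivialProtocol_expectedError]
      exact zero_le
    · have : u = [] := (PMF.mem_support_pure_iff _ _).1 hu
      rw [this, List.length_nil, Nat.cast_zero]
      positivity
  have hB' : (2 : ℝ) ≤ B := by exact_mod_cast hB2
  have hlogB : Real.log 2 ≤ Real.log B := Real.log_le_log (by norm_num) hB'
  obtain ⟨P, e, b, κ, hides, hcenter, hmass⟩ := hP n hn
  have hclog : B ≤ 2 ^ Nat.clog 2 B := Nat.le_pow_clog (by norm_num) B
  have hmsg : Function.Injective fun j : Fin B => BitVec.ofFin (Fin.castLE hclog j) := by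
    intro i j h
    exact Fin.castLE_injective hclog (BitVec.ofFin.inj h)
  refine ⟨Nat.clog 2 B, ?_, histogramProtocol P n fun j => BitVec.ofFin (Fin.castLE hclog j),
    histogramProtocol_isPureShuffledDP _ hn hε hides, fun x => ?_, fun x u hu => ?_⟩
  -- Rounding up costs at most 1, which is at most log B / log 2 as B ≥ 2; hence the 2 in the
  -- absolute constant.
  · have h1 : ((Nat.clog 2 B - 1 : ℕ) : ℝ) * Real.log 2 ≤ Real.log B := by
      rw [← Real.log_pow]
      apply Real.log_le_log (by positivity)
      exact_mod_cast (Nat.pow_pred_clog_lt_self (by norm_num) hB2).le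
    have h2 : (Nat.clog 2 B : ℝ) ≤ (Nat.clog 2 B - 1 : ℕ) + 1 := by
      exact_mod_cast (by omega : Nat.clog 2 B ≤ Nat.clog 2 B - 1 + 1)
    rw [div_mul_eq_mul_div, le_div_iff₀ hlog2]
    nlinarith
  · refine (histogramProtocol_expectedError_le P hmsg hB (by omega) hL.le hmass x).trans
      (ENNReal.ofReal_le_ofReal ?_)
    -- The additive constant is absorbed into log B ≥ log 2.
    have h1 : Real.exp (L * Real.exp 1)
        ≤ Real.exp (L * Real.exp 1) / Real.log 2 * Real.log B := by
      rw [div_mul_eq_mul_div, le_div_iff₀ hlog2]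
      gcongr
    calc ((P.center : ℝ) + 1) * (Real.log B + Real.exp (L * Real.exp 1))
        ≤ C * Real.log n * (Real.log B
          + Real.exp (L * Real.exp 1) / Real.log 2 * Real.log B) := by gcongr
      _ = _ := by ring
  · refine (histogramProtocol_sendsAtMost P n _ x u hu).trans ?_
    push_cast
    nlinarith [Nat.cast_nonneg (α := ℝ) B]
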